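/- All matroids have finite ground sets, and $r(M)$ denotes the rank of $M$. A matroid $M$ on the set $E(M)$ is *transversal* if there are finitely many subsets $A_1,\dots,A_r$ of $E(M)$ (repetitions allowed), called a *presentation* of $M$, such that the independent sets of $M$ are exactly the partial transversals of $(A_1,\dots,A_r)$, that is, the sets $I$ for which there is an injection $\phi:I\to\{1,\dots,r\}$ with $x\in A_{\phi(x)}$ for all $x\in I$. It is *fundamental transversal* if it has a presentation $(A_1,\dots,A_r)$ such that $A_i\setminus\bigcup_{j\neq i}A_j\neq\emptyset$ for every $i$. It is *cotransversal* if its dual $M^*$ is transversal. For matroids $M$ and $N$ on disjoint sets, the *free product* $M\mathbin{\Box}N$ is the matroid on $E(M)\cup E(N)$ whose bases are the sets $B\subseteq E(M)\cup E(N)$ such that $|B|=r(M)+r(N)$, $B\cap E(M)$ is independent in $M$, and $B\cap E(N)$ spans $N$. **Theorem.** Let $M$ and $N$ be matroids on disjoint finite ground sets. Then 1. $M\mathbin{\Box}N$ is transversal if and only if both $M$ and $N$ are transversal; 2. $M\mathbin{\Box}N$ is fundamental transversal if and only if both $M$ and $N$ are fundamental transversal; 3. $M\mathbin{\Box}N$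 is cotransversal if and only if both $M$ and $N$ are cotransversal; 4. $M\mathbin{\Box}N$ is both transversal and cotransversal if and only if each of $M$ and $N$ is both transversal and cotransversal. -/

import Mathlib

open Set

namespace Matroid

/-- `I` is a partial transversal of the set system `A` (a finite indexed family of sets): there is
an injection `φ` from `I` to the index set with `x ∈ A (φ x)` for all `x ∈ I`. -/
def IsPartialTransversal {α : Type*} {r : ℕ} (A : Fin r → Set α) (I : Set α) : Prop :=
  ∃ φ : I → Fin r, Function.Injective φ ∧ ∀ x : I, (x : α) ∈ A (φ x)

/-- The set system `A` on the ground set of `M` is a presentation of `M`: the independent sets of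
`M` are exactly the partial transversals of `A`. -/
def IsPresentation {α : Type*} (M : Matroid α) {r : ℕ} (A : Fin r → Set α) : Prop :=
  (∀ i, A i ⊆ M.E) ∧ ∀ I : Set α, M.Indep I ↔ IsPartialTransversal A I

/-- A matroid is transversal if it has a presentation by a finite set system. -/
def IsTransversal {α : Type*} (M : Matroid α) : Prop :=
  ∃ (r : ℕ) (A : Fin r → Set α), M.IsPresentation A

/-- A matroid is fundamental transversal if it has a presentation in which every set has an
element that lies in none of the other sets. -/
def IsFundamentalTransversal {α : Type*} (M : Matroid α) : Prop :=
  ∃ (r : ℕ) (A : Fin r → Set α), M.IsPresentation A ∧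
    ∀ i, (A i \ ⋃ (j : Fin r) (_ : j ≠ i), A j).Nonempty

/-- A matroid is cotransversal if its dual is transversal. -/
def IsCotransversal {α : Type*} (M : Matroid α) : Prop :=
  M✶.IsTransversal

/-- The bases of the free product of `M` and `N`: subsets `B` of `E(M) ∪ E(N)` of size
`r(M) + r(N)` such that `B ∩ E(M)` is independent in `M` and `B ∩ E(N)` spans `N`. -/
def IsFreeProductBase {α : Type*} (M N : Matroid α) (B : Set α) : Prop :=
  B ⊆ M.E ∪ N.E ∧ B.encard = M.eRank + N.eRank ∧ M.Indep (B ∩ M.E) ∧ N.Spanning (B ∩ N.E)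

theorem exists_isFreeProductBase {α : Type*} (M N : Matroid α) (h : Disjoint M.E N.E) :
    ∃ B, IsFreeProductBase M N B := by
  obtain ⟨B, hB⟩ := M.exists_isBase
  obtain ⟨C, hC⟩ := N.exists_isBase
  have hBN : B ∩ N.E = ∅ := (h.mono_left hB.subset_ground).inter_eq
  have hCM : C ∩ M.E = ∅ := (h.symm.mono_left hC.subset_ground).inter_eq
  refine ⟨B ∪ C, union_subset_union hB.subset_ground hC.subset_ground, ?_, ?_, ?_⟩
  · rw [encard_union_eq (h.mono hB.subset_ground hC.subset_ground), hB.encard_eq_eRank,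
      hC.encard_eq_eRank]
  · rw [union_inter_distrib_right, hCM, union_empty, inter_eq_left.2 hB.subset_ground]
    exact hB.indep
  · rw [union_inter_distrib_right, hBN, empty_union, inter_eq_left.2 hC.subset_ground]
    exact hC.spanning

theorem isFreeProductBase_exchange {α : Type*} (M N : Matroid α) [M.Finite] [N.Finite]
    (h : Disjoint M.E N.E) : ExchangeProperty (IsFreeProductBase M N) := by
  rintro B B' ⟨hBE, hBc, hBM, hBN⟩ ⟨hBE', hBc', hBM', hBN'⟩ x ⟨hxB, hxB'⟩
  have hfin : (M.E ∪ N.E).Finite := M.ground_finite.union N.ground_finite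
  have hsplit : ∀ X ⊆ M.E ∪ N.E, X.encard = (X ∩ M.E).encard + (X ∩ N.E).encard := by
    intro X hX
    rw [← encard_union_eq (h.mono inter_subset_right inter_subset_right),
      ← inter_union_distrib_left, inter_eq_left.2 hX]
  -- exchanging `x` for `y` keeps the size
  have hcard : ∀ y ∈ B' \ B, (insert y (B \ {x})).encard = M.eRank + N.eRank := by
    intro y hy
    rw [encard_insert_of_notMem (fun hh ↦ hy.2 hh.1), encard_sdiff_singleton_add_one hxB, hBc]
  have hsub : ∀ y ∈ B' \ B, insert y (B \ {x}) ⊆ M.E ∪ N.E := fun y hy ↦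
    insert_subset (hBE' hy.1) (sdiff_subset.trans hBE)
  -- it suffices to keep the two remaining conditions
  by_cases hsp : N.Spanning ((B \ {x}) ∩ N.E)
  · by_cases hy : ∃ y ∈ B' \ B, y ∈ N.E
    · obtain ⟨y, hy, hyN⟩ := hy
      have hyM : y ∉ M.E := fun hyM ↦ h.le_bot ⟨hyM, hyN⟩
      refine ⟨y, hy, hsub y hy, hcard y hy, ?_, ?_⟩
      · rw [insert_inter_of_notMem hyM]
        exact hBM.subset (inter_subset_inter_left _ sdiff_subset)
      · exact hsp.superset (inter_subset_inter_left _ (subset_insert _ _)) inter_subset_right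
    · have hss : B' ∩ N.E ⊆ (B \ {x}) ∩ N.E := by
        rintro z ⟨hzB', hzN⟩
        have hzB : z ∈ B := by
          by_contra hzB
          exact hy ⟨z, ⟨hzB', hzB⟩, hzN⟩
        exact ⟨⟨hzB, fun hzx ↦ hxB' (by rw [← mem_singleton_iff.1 hzx]; exact hzB')⟩, hzN⟩
      have hlt : ((B \ {x}) ∩ M.E).encard < (B' ∩ M.E).encard := by
        have h1 := hsplit _ (sdiff_subset.trans hBE : B \ {x} ⊆ _)
        have h2 := hsplit _ hBE'
        have h3 := encard_sdiff_singleton_add_one hxB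
        have h4 := encard_le_encard hss
        rw [hBc, ← hBc', h1, h2] at h3
        have f1 : ((B \ {x}) ∩ M.E).encard ≠ ⊤ :=
          encard_ne_top_iff.2 (M.ground_finite.subset inter_subset_right)
        have f2 : ((B \ {x}) ∩ N.E).encard ≠ ⊤ :=
          encard_ne_top_iff.2 (N.ground_finite.subset inter_subset_right)
        have f3 : (B' ∩ M.E).encard ≠ ⊤ :=
          encard_ne_top_iff.2 (M.ground_finite.subset inter_subset_right)
        have f4 : (B' ∩ N.E).encard ≠ ⊤ :=
          encard_ne_top_iff.2 (N.ground_finite.subset inter_subset_right)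
        generalize ((B \ {x}) ∩ M.E).encard = a at *
        generalize ((B \ {x}) ∩ N.E).encard = b at *
        generalize (B' ∩ M.E).encard = c at *
        generalize (B' ∩ N.E).encard = d at *
        lift a to ℕ using f1
        lift b to ℕ using f2
        lift c to ℕ using f3
        lift d to ℕ using f4
        norm_cast at *
        omega
      have hI : M.Indep ((B \ {x}) ∩ M.E) :=
        hBM.subset (inter_subset_inter_left _ sdiff_subset)
      obtain ⟨y, ⟨hy1, hy2⟩, hyI⟩ := hI.exists_insert_of_encard_lt hBM' hlt
      have hyB : y ∉ B := fun hyB ↦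
        hy2 ⟨⟨hyB, fun hyx ↦ hxB' (by rw [← mem_singleton_iff.1 hyx]; exact hy1.1)⟩, hy1.2⟩
      refine ⟨y, ⟨hy1.1, hyB⟩, hsub y ⟨hy1.1, hyB⟩, hcard y ⟨hy1.1, hyB⟩, ?_, ?_⟩
      · rwa [insert_inter_of_mem hy1.2]
      · exact hsp.superset (inter_subset_inter_left _ (subset_insert _ _)) inter_subset_right
  · -- now `x` is an element of `N` that is needed for spanning
    have hxN : x ∈ N.E := by
      by_contra hxN
      apply hsp
      rwa [inter_sdiff_right_comm.symm, sdiff_singleton_eq_self (fun hh ↦ hxN hh.2)]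
    have hins : insert x ((B \ {x}) ∩ N.E) = B ∩ N.E := by
      rw [← insert_inter_of_mem hxN, insert_sdiff_singleton, insert_eq_of_mem hxB]
    have hy : ∃ y ∈ B' ∩ N.E, y ∉ N.closure ((B \ {x}) ∩ N.E) := by
      by_contra! hcon
      apply hsp
      rw [spanning_iff_ground_subset_closure inter_subset_right]
      calc N.E = N.closure (B' ∩ N.E) := hBN'.closure_eq.symm
        _ ⊆ _ := N.closure_subset_closure_of_subset_closure hcon
    obtain ⟨y, ⟨hyB', hyN⟩, hy⟩ := hy
    have hyM : y ∉ M.E := fun hyM ↦ h.le_bot ⟨hyM, hyN⟩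
    have hyx : y ≠ x := fun hyx ↦ hxB' (hyx ▸ hyB')
    have hyB : y ∉ B := fun hyB ↦
      hy (N.mem_closure_of_mem ⟨⟨hyB, hyx⟩, hyN⟩ inter_subset_right)
    refine ⟨y, ⟨hyB', hyB⟩, hsub y ⟨hyB', hyB⟩, hcard y ⟨hyB', hyB⟩, ?_, ?_⟩
    · rw [insert_inter_of_notMem hyM]
      exact hBM.subset (inter_subset_inter_left _ sdiff_subset)
    · rw [insert_inter_of_mem hyN]
      have hmem : y ∈ N.closure (insert x ((B \ {x}) ∩ N.E)) \ N.closure ((B \ {x}) ∩ N.E) := by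
        rw [hins, hBN.closure_eq]
        exact ⟨hyN, hy⟩
      rw [spanning_iff_closure_eq (insert_subset hyN inter_subset_right),
        closure_insert_congr hmem, hins, hBN.closure_eq]

/-- The free product `M □ N` of two matroids on disjoint finite ground sets: the matroid on
`E(M) ∪ E(N)` whose bases are the sets `B` with `IsFreeProductBase M N B`. -/
def freeProduct {α : Type*} (M N : Matroid α) [M.Finite] [N.Finite] (h : Disjoint M.E N.E) :
    Matroid α :=
  Matroid.ofIsBaseOfFinite (E := M.E ∪ N.E) (M.ground_finite.union N.ground_finite)
    (IsFreeProductBase M N) (exists_isFreeProductBase M N h) (isFreeProductBase_exchange M N h)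
    (fun _ hB ↦ hB.1)

end Matroid

namespace Matroid

variable {α ι : Type*}

/-! Write G for the free product. It restricts to `M` on E(M), its contraction by E(M) is `N`, and
its dual is the free product of `N✶` and `M✶`. The cotransversal claim follows from the transversal
one by duality, and the last claim is the conjunction of those two.

Building up (`Presents.freeProduct`): take a presentation of `M` by exactly r(M) sets, enlarge each
of them by E(N) \ Y for an independent set Y of `N`, and append a presentation of `N`. This presents
G. The choice Y = ∅ settles transversality; letting Y consist of private elements of the sets
presenting `N` keeps them private.

Going down rests on one fact (`Indep.freeProduct_exchange`): in an independent set of G, an element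
of E(M) may be replaced by any element of E(N). Transversality passes to restrictions, which gives
`M`, but not to contractions in general. However, in a maximal presentation of G the exchange forces
every set meeting E(M) to contain E(N); the sets left unused by a matching of a base of `M` then
present `N`.

For fundamental transversality, an intrinsic criterion replaces presentations: some base B has the
property that B ∩ cl(C) spans C for every circuit C. Exchange shows that such a base of G can be
chosen to split into bases of `M` and `N`, and these inherit the property. -/

/-- `I` can be matched injectively into the sets `A i` with `i ∈ S`. -/
def Linkable (A : ι → Set α) (S : Set ι) (I : Set α) : Prop :=
  ∃ f : I → ι, Function.Injective f ∧ ∀ x, f x ∈ S ∧ (x : α) ∈ A (f x)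

/-- The indices of the sets in the family `A` that meet `D`. -/
def nbhd (A : ι → Set α) (D : Set α) : Set ι := {i | (A i ∩ D).Nonempty}

/-- The independent sets of `M` are those matched into the sets `A i` with `i ∈ S`. -/
def Presents (M : Matroid α) (A : ι → Set α) (S : Set ι) : Prop :=
  ∀ I, M.Indep I ↔ Linkable A S I

/-! ### Matchings into set systems and Hall's condition. -/

section Linkable

variable {A A' : ι → Set α} {S T : Set ι} {I J : Set α}

theorem Linkable.mono (h : Linkable A S I) (hJ : J ⊆ I)
    (hA : ∀ x ∈ J, ∀ i ∈ S, x ∈ A i → i ∈ T ∧ x ∈ A' i) : Linkable A' T J := by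
  obtain ⟨f, hf, h⟩ := h
  refine ⟨fun x ↦ f ⟨x, hJ x.2⟩, fun x y hxy ↦ ?_, fun x ↦ hA x x.2 _ (h ⟨x, hJ x.2⟩).1 (h _).2⟩
  have := hf hxy
  simpa [Subtype.ext_iff] using this

theorem Linkable.subset (h : Linkable A S I) (hJ : J ⊆ I) : Linkable A S J :=
  h.mono hJ fun _ _ _ hi hx ↦ ⟨hi, hx⟩

theorem Linkable.mono_right (h : Linkable A S I) (hS : S ⊆ T) : Linkable A T I :=
  h.mono subset_rfl fun _ _ _ hi hx ↦ ⟨hS hi, hx⟩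

theorem Linkable.union (hI : Linkable A S I) (hJ : Linkable A T J) (hST : Disjoint S T) :
    Linkable A (S ∪ T) (I ∪ J) := by
  classical
  obtain ⟨f, hf, hf'⟩ := hI
  obtain ⟨g, hg, hg'⟩ := hJ
  have key : ∀ x : ↥(I ∪ J), (x : α) ∉ I → (x : α) ∈ J := fun x hx ↦ x.2.resolve_left hx
  have hne : ∀ x y, f x ≠ g y := fun x y hxy ↦
    hST.le_bot ⟨(hf' x).1, hxy ▸ (hg' y).1⟩
  refine ⟨fun x ↦ if hx : (x : α) ∈ I then f ⟨x, hx⟩ else g ⟨x, key x hx⟩, ?_, ?_⟩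
  · intro x y hxy
    by_cases hx : (x : α) ∈ I <;> by_cases hy : (y : α) ∈ I
    · simp only [hx, hy, dif_pos] at hxy
      simpa [Subtype.ext_iff] using hf hxy
    · simp only [hx, hy, dif_pos, dif_neg, not_false_eq_true] at hxy
      exact (hne _ _ hxy).elim
    · simp only [hx, hy, dif_pos, dif_neg, not_false_eq_true] at hxy
      exact (hne _ _ hxy.symm).elim
    · simp only [hx, hy, dif_neg, not_false_eq_true] at hxy
      simpa [Subtype.ext_iff] using hg hxy
  · intro x
    by_cases hx : (x : α) ∈ I
    · simp only [hx, dif_pos]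
      exact ⟨Or.inl (hf' ⟨x, hx⟩).1, (hf' ⟨x, hx⟩).2⟩
    · simp only [hx, dif_neg, not_false_eq_true]
      exact ⟨Or.inr (hg' ⟨x, _⟩).1, (hg' ⟨x, key x hx⟩).2⟩

theorem Linkable.exists_split (h : Linkable A (S ∪ T) I) :
    ∃ J K, J ∪ K = I ∧ Disjoint J K ∧ Linkable A S J ∧ Linkable A T K := by
  obtain ⟨f, hf, h⟩ := h
  refine ⟨Subtype.val '' (f ⁻¹' S), Subtype.val '' (f ⁻¹' Sᶜ), ?_, ?_, ?_, ?_⟩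
  · rw [← image_union, ← preimage_union, union_compl_self, preimage_univ, image_univ,
      Subtype.range_coe]
  · rw [disjoint_image_iff Subtype.val_injective]
    exact Disjoint.preimage _ disjoint_compl_right
  · have hm : ∀ x : ↥(Subtype.val '' (f ⁻¹' S)), ∃ hx : (x : α) ∈ I, f ⟨x, hx⟩ ∈ S := by
      rintro ⟨_, y, hy, rfl⟩
      exact ⟨y.2, hy⟩
    refine ⟨fun x ↦ f ⟨x, (hm x).1⟩, fun x y hxy ↦ ?_, fun x ↦ ⟨(hm x).2, (h _).2⟩⟩
    simpa [Subtype.ext_iff] using hf hxy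
  · have hm : ∀ x : ↥(Subtype.val '' (f ⁻¹' Sᶜ)), ∃ hx : (x : α) ∈ I, f ⟨x, hx⟩ ∉ S := by
      rintro ⟨_, y, hy, rfl⟩
      exact ⟨y.2, hy⟩
    refine ⟨fun x ↦ f ⟨x, (hm x).1⟩, fun x y hxy ↦ ?_,
      fun x ↦ ⟨(h _).1.resolve_left (hm x).2, (h _).2⟩⟩
    simpa [Subtype.ext_iff] using hf hxy

theorem Linkable.encard_le (h : Linkable A S I) : I.encard ≤ S.encard := by
  obtain ⟨f, hf, h⟩ := h
  have : I.encard = (range f).encard := by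
    rw [← image_univ, hf.encard_image, encard_univ, ENat.card_coe_set_eq]
  rw [this]
  exact encard_le_encard (by rintro _ ⟨x, rfl⟩; exact (h x).1)

theorem Linkable.exists_image (h : Linkable A S I) :
    ∃ T ⊆ S, T.encard = I.encard ∧ Linkable A T I := by
  obtain ⟨f, hf, h⟩ := h
  refine ⟨range f, ?_, ?_, f, hf, fun x ↦ ⟨mem_range_self x, (h x).2⟩⟩
  · rintro _ ⟨x, rfl⟩; exact (h x).1
  · rw [← image_univ, hf.encard_image, encard_univ, ENat.card_coe_set_eq]

theorem linkable_of_encard_le (h : I.encard ≤ S.encard) (hI : I.Finite) (hA : ∀ i ∈ S, I ⊆ A i) :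
    Linkable A S I := by
  obtain ⟨T, hTS, hT⟩ := exists_subset_encard_eq h
  have hTf : T.Finite := by
    rw [← encard_lt_top_iff, hT]; exact hI.encard_lt_top
  have := hI.to_subtype
  have := hTf.to_subtype
  have hc : Nat.card I = Nat.card T := by
    rw [Nat.card_coe_set_eq, Nat.card_coe_set_eq, ncard_def, ncard_def, hT]
  obtain ⟨e⟩ := (Finite.card_eq.1 hc)
  exact ⟨fun x ↦ e x, Subtype.val_injective.comp e.injective,
    fun x ↦ ⟨hTS (e x).2, hA _ (hTS (e x).2) x.2⟩⟩

theorem linkable_singleton {x : α} {i : ι} (hi : i ∈ S) (hx : x ∈ A i) : Linkable A S {x} :=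
  ⟨fun _ ↦ i, fun a b _ ↦ Subsingleton.elim a b,
    fun y ↦ ⟨hi, by rw [show (y : α) = x from y.2]; exact hx⟩⟩

/-- Hall's marriage theorem, with the available sets limited to `S`. -/
theorem linkable_iff [Finite ι] (hI : I.Finite) :
    Linkable A S I ↔ ∀ D ⊆ I, D.encard ≤ (S ∩ nbhd A D).encard := by
  classical
  constructor
  · intro h D hD
    exact Linkable.encard_le (A := A)
      (h.mono hD fun x hx i hi hxi ↦ ⟨⟨hi, x, hxi, hx⟩, hxi⟩)
  · intro h
    have := hI.to_subtype
    have := Fintype.ofFinite I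
    have := Fintype.ofFinite ι
    have key := (Fintype.all_card_le_filter_rel_iff_exists_injective
      (fun (x : I) (i : ι) ↦ i ∈ S ∧ (x : α) ∈ A i)).1 ?_
    · exact key
    intro D
    have h1 := h (Subtype.val '' (D : Set I)) (by simp)
    rw [Subtype.val_injective.encard_image, encard_coe_eq_coe_finsetCard] at h1
    have h2 : S ∩ nbhd A (Subtype.val '' (D : Set I)) =
        ((Finset.univ.filter fun i ↦ ∃ x ∈ D, i ∈ S ∧ (x : α) ∈ A i : Finset ι) : Set ι) := by
      ext i
      constructor
      · rintro ⟨hi, x, hx, y, hy, rfl⟩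
        exact Finset.mem_coe.2 (Finset.mem_filter.2 ⟨Finset.mem_univ _, y, hy, hi, hx⟩)
      · intro hi
        obtain ⟨x, hx, hi, hxi⟩ := (Finset.mem_filter.1 (Finset.mem_coe.1 hi)).2
        exact ⟨hi, x, hxi, x, hx, rfl⟩
    rw [h2, encard_coe_eq_coe_finsetCard] at h1
    exact_mod_cast h1

theorem nbhd_union (A : ι → Set α) (D D' : Set α) : nbhd A (D ∪ D') = nbhd A D ∪ nbhd A D' := by
  ext i
  simp [nbhd, inter_union_distrib_left, union_nonempty]

theorem nbhd_mono (A : ι → Set α) {D D' : Set α} (h : D ⊆ D') : nbhd A D ⊆ nbhd A D' :=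
  fun _ hi ↦ hi.mono (inter_subset_inter_right _ h)

end Linkable

/-! ### Presentations indexed by arbitrary types, and their size. -/

theorem Presents.subset_ground {M : Matroid α} {A : ι → Set α} {S : Set ι} (h : M.Presents A S)
    {i : ι} (hi : i ∈ S) : A i ⊆ M.E :=
  fun _ hx ↦ singleton_subset_iff.1 ((h _).2 (linkable_singleton hi hx)).subset_ground

theorem isPresentation_iff {M : Matroid α} {r : ℕ} {A : Fin r → Set α} :
    M.IsPresentation A ↔ M.Presents A univ := by
  have h : ∀ I, IsPartialTransversal A I ↔ Linkable A univ I := fun I ↦ by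
    simp [IsPartialTransversal, Linkable]
  refine ⟨fun hA I ↦ (hA.2 I).trans (h I), fun hA ↦
    ⟨fun i ↦ hA.subset_ground (mem_univ i), fun I ↦ (hA I).trans (h I).symm⟩⟩

theorem Presents.exists_fin [Finite ι] {M : Matroid α} {A : ι → Set α} {S : Set ι}
    (h : M.Presents A S) :
    ∃ (r : ℕ) (e : Fin r ≃ S), M.IsPresentation (fun i ↦ A (e i)) := by
  obtain ⟨r, ⟨e⟩⟩ := Finite.exists_equiv_fin S
  refine ⟨r, e.symm, isPresentation_iff.2 fun I ↦ (h I).trans ?_⟩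
  constructor
  · rintro ⟨f, hf, hA⟩
    refine ⟨fun x ↦ e ⟨f x, (hA x).1⟩, fun x y hxy ↦ hf ?_, fun x ↦ ⟨mem_univ _, ?_⟩⟩
    · simpa using hxy
    · simpa using (hA x).2
  · rintro ⟨f, hf, hA⟩
    exact ⟨fun x ↦ e.symm (f x), fun x y hxy ↦ hf (e.symm.injective (Subtype.ext hxy)),
      fun x ↦ ⟨(e.symm (f x)).2, (hA x).2⟩⟩

theorem Presents.isTransversal [Finite ι] {M : Matroid α} {A : ι → Set α} {S : Set ι}
    (h : M.Presents A S) : M.IsTransversal :=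
  let ⟨r, _, he⟩ := h.exists_fin
  ⟨r, _, he⟩

theorem Presents.isFundamentalTransversal [Finite ι] {M : Matroid α} {A : ι → Set α} {S : Set ι}
    (h : M.Presents A S) (hp : ∀ i ∈ S, ∃ x ∈ A i, ∀ j ∈ S, x ∈ A j → j = i) :
    M.IsFundamentalTransversal := by
  obtain ⟨r, e, he⟩ := h.exists_fin
  refine ⟨r, _, he, fun i ↦ ?_⟩
  obtain ⟨x, hx, hxj⟩ := hp (e i) (e i).2
  refine ⟨x, hx, fun hmem ↦ ?_⟩
  simp only [mem_iUnion] at hmem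
  obtain ⟨j, hj, hxj'⟩ := hmem
  exact hj (e.injective (Subtype.ext (hxj _ (e j).2 hxj')))

theorem IsFundamentalTransversal.exists_presents {M : Matroid α}
    (h : M.IsFundamentalTransversal) :
    ∃ (r : ℕ) (A : Fin r → Set α) (y : Fin r → α), M.Presents A univ ∧
      ∀ i j, y i ∈ A j ↔ j = i := by
  obtain ⟨r, A, hA, hp⟩ := h
  choose y hy using hp
  refine ⟨r, A, y, isPresentation_iff.1 hA, fun i j ↦ ⟨fun hij ↦ ?_, ?_⟩⟩
  · by_contra hne
    exact (hy i).2 (by simpa using ⟨j, hne, hij⟩)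
  · rintro rfl
    exact (hy _).1

theorem Presents.indep_range {M : Matroid α} {A : ι → Set α} {y : ι → α}
    (hA : M.Presents A univ) (hy : ∀ i j, y i ∈ A j ↔ j = i) : M.Indep (range y) := by
  have hex : ∀ x : range y, ∃ i, y i = x := fun x ↦ x.2
  choose f hf using hex
  refine (hA _).2 ⟨f, fun a b hab ↦ ?_, fun a ↦ ⟨mem_univ _, ?_⟩⟩
  · rw [Subtype.ext_iff, ← hf, ← hf, hab]
  · rw [← hf a]
    exact (hy _ _).2 rfl

/-- The private elements `y i` form an independent set with one element per set, and no independent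
set can have more elements than there are sets. -/
theorem Presents.encard_univ_eq {M : Matroid α} {A : ι → Set α} {y : ι → α}
    (hA : M.Presents A univ) (hy : ∀ i j, y i ∈ A j ↔ j = i) :
    (univ : Set ι).encard = M.eRank := by
  have hyinj : Function.Injective y := fun i j hij ↦ (hy j i).1 (hij ▸ (hy i i).2 rfl)
  refine le_antisymm ?_ ?_
  · rw [← hyinj.encard_image, image_univ]
    exact (hA.indep_range hy).encard_le_eRank
  · obtain ⟨C, hC⟩ := M.exists_isBase
    rw [← hC.encard_eq_eRank]
    exact ((hA C).1 hC.indep).encard_le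

/-- A finite matroid presented by finitely many sets is presented by `r(M)` of them. -/
theorem Presents.exists_encard_eq_eRank [Finite ι] {M : Matroid α} [M.Finite] {A : ι → Set α}
    {S : Set ι} (h : M.Presents A S) : ∃ T ⊆ S, T.encard = M.eRank ∧ M.Presents A T := by
  obtain ⟨B, hB⟩ := M.exists_isBase
  obtain ⟨T, hTS, hTB, hT⟩ := ((h B).1 hB.indep).exists_image
  refine ⟨T, hTS, hTB.trans hB.encard_eq_eRank, fun I ↦
    ⟨fun hI ↦ ?_, fun hI ↦ (h I).2 (hI.mono_right hTS)⟩⟩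
  rw [linkable_iff (M.ground_finite.subset hI.subset_ground)]
  intro D hDI
  -- Let J be the part of the base matched to sets missing D, and K the rest. Then D ∪ J is
  -- independent, so |D| + |J| ≤ |J| + |K|, and K is matched into the sets of `T` that meet D.
  have hT' : Linkable A ((T \ nbhd A D) ∪ (T ∩ nbhd A D)) B :=
    hT.mono_right (by rw [sdiff_union_inter])
  obtain ⟨J, K, hJK, hdj, hJ, hK⟩ := hT'.exists_split
  have hD : Linkable A (S ∩ nbhd A D) D := ((h I).1 hI).mono hDI
    fun x hx i hi hxi ↦ ⟨⟨hi, x, hxi, hx⟩, hxi⟩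
  have hDJ : M.Indep (D ∪ J) := (h _).2 <| (hD.union hJ
    (disjoint_sdiff_right.mono_left inter_subset_right)).mono_right
      (union_subset inter_subset_left (sdiff_subset.trans hTS))
  have hdj' : Disjoint D J := by
    rw [Set.disjoint_left]
    intro x hxD hxJ
    obtain ⟨f, -, hf⟩ := hJ
    exact (hf ⟨x, hxJ⟩).1.2 ⟨x, (hf ⟨x, hxJ⟩).2, hxD⟩
  have h1 := hDJ.encard_le_eRank
  rw [encard_union_eq hdj', ← hB.encard_eq_eRank, ← hJK, encard_union_eq hdj] at h1
  have h2 := hK.encard_le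
  have h3 : J.encard ≠ ⊤ := encard_ne_top_iff.2
    (M.ground_finite.subset ((subset_union_left.trans hJK.subset).trans hB.subset_ground))
  rw [add_comm] at h1
  exact ((ENat.add_le_add_iff_left h3).1 h1).trans h2

/-! ### Independence, minors and duality of the free product. -/

theorem eRank_ne_top_of_finite {α : Type*} (M : Matroid α) [M.Finite] : M.eRank ≠ ⊤ :=
  (M.eRank_le_encard_ground.trans_lt M.ground_finite.encard_lt_top).ne

theorem inter_union_inter_eq {α : Type*} {E F X : Set α} (hX : X ⊆ E ∪ F) :
    X ∩ E ∪ X ∩ F = X := by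
  rw [← inter_union_distrib_left, inter_eq_left.2 hX]

theorem encard_inter_add_encard_inter {α : Type*} {E F : Set α} (h : Disjoint E F) {X : Set α}
    (hX : X ⊆ E ∪ F) :
    (X ∩ E).encard + (X ∩ F).encard = X.encard := by
  rw [← encard_union_eq (h.mono inter_subset_right inter_subset_right),
    inter_union_inter_eq hX]

theorem union_inter_left_of_disjoint {α : Type*} {E F : Set α} (h : Disjoint E F) {I J : Set α}
    (hI : I ⊆ E) (hJ : J ⊆ F) :
    (I ∪ J) ∩ E = I := by
  rw [union_inter_distrib_right, inter_eq_left.2 hI, (h.symm.mono_left hJ).inter_eq, union_empty]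

theorem union_inter_right_of_disjoint {α : Type*} {E F : Set α} (h : Disjoint E F) {I J : Set α}
    (hI : I ⊆ E) (hJ : J ⊆ F) :
    (I ∪ J) ∩ F = J := by
  rw [union_inter_distrib_right, inter_eq_left.2 hJ, (h.mono_left hI).inter_eq, empty_union]

section FreeProduct

variable {α : Type*} {M N : Matroid α} [M.Finite] [N.Finite] (h : Disjoint M.E N.E)

theorem freeProduct_ground : (M.freeProduct N h).E = M.E ∪ N.E := rfl

theorem freeProduct_isBase_iff {B : Set α} :
    (M.freeProduct N h).IsBase B ↔ IsFreeProductBase M N B := Iff.rfl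

instance freeProduct_finite : (M.freeProduct N h).Finite :=
  ⟨M.ground_finite.union N.ground_finite⟩

theorem freeProduct_isBase_union {I J : Set α} (hI : M.Indep I) (hJ : N.Spanning J)
    (hc : I.encard + J.encard = M.eRank + N.eRank) : (M.freeProduct N h).IsBase (I ∪ J) := by
  rw [freeProduct_isBase_iff]
  refine ⟨union_subset_union hI.subset_ground hJ.subset_ground, ?_, ?_, ?_⟩
  · rw [encard_union_eq (h.mono hI.subset_ground hJ.subset_ground), hc]
  · rwa [union_inter_left_of_disjoint h hI.subset_ground hJ.subset_ground]
  · rwa [union_inter_right_of_disjoint h hI.subset_ground hJ.subset_ground]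

theorem freeProduct_indep_union {I J : Set α} (hI : M.Indep I) (hJ : N.Spanning J)
    (hc : I.encard + J.encard ≤ M.eRank + N.eRank) : (M.freeProduct N h).Indep (I ∪ J) := by
  obtain ⟨B, hB, hIB⟩ := hI.exists_isBase_superset
  have hJr : N.eRank ≤ J.encard := hJ.eRk_eq ▸ N.eRk_le_encard J
  have hIr := hI.encard_le_eRank
  have hM := M.eRank_ne_top_of_finite
  have hN := N.eRank_ne_top_of_finite
  have hJf : J.encard ≠ ⊤ := encard_ne_top_iff.2 (N.ground_finite.subset hJ.subset_ground)
  have hIf : I.encard ≠ ⊤ := encard_ne_top_iff.2 (M.ground_finite.subset hI.subset_ground)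
  -- The size to which `I` must grow inside a base of `M` for the total to become r(M) + r(N).
  obtain ⟨k, hk, hIk, hkB⟩ : ∃ k : ℕ∞, k + J.encard = M.eRank + N.eRank ∧ I.encard ≤ k ∧
      k ≤ B.encard := by
    rw [hB.encard_eq_eRank]
    generalize I.encard = i at *
    generalize J.encard = j at *
    generalize M.eRank = m at *
    generalize N.eRank = n at *
    lift i to ℕ using hIf
    lift j to ℕ using hJf
    lift m to ℕ using hM
    lift n to ℕ using hN
    norm_cast at *
    refine ⟨((m + n - j : ℕ) : ℕ∞), ?_, ?_, ?_⟩ <;> norm_cast <;> omega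
  obtain ⟨I', hII', hI'B, hI'⟩ := exists_superset_subset_encard_eq hIB hIk hkB
  exact (freeProduct_isBase_union h (hB.indep.subset hI'B) hJ (hI' ▸ hk)).indep.subset
    (union_subset_union_left _ hII')

theorem Indep.freeProduct_inter_left {I : Set α} (hI : (M.freeProduct N h).Indep I) :
    M.Indep (I ∩ M.E) := by
  obtain ⟨B, hB, hIB⟩ := hI.exists_isBase_superset
  exact hB.2.2.1.subset (inter_subset_inter_left _ hIB)

theorem freeProduct_indep_iff_of_subset_left {I : Set α} (hI : I ⊆ M.E) :
    (M.freeProduct N h).Indep I ↔ M.Indep I := by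
  refine ⟨fun hI' ↦ inter_eq_left.2 hI ▸ hI'.freeProduct_inter_left h, fun hI' ↦ ?_⟩
  obtain ⟨B, hB⟩ := N.exists_isBase
  exact (freeProduct_indep_union h hI' hB.spanning (by
    rw [hB.encard_eq_eRank]; gcongr; exact hI'.encard_le_eRank)).subset subset_union_left

/-- A base of the free product containing a base of `M` has exactly r(N) elements in E(N); as these
span `N`, they form a base of it. -/
theorem freeProduct_indep_union_iff {B J : Set α} (hB : M.IsBase B) (hJ : J ⊆ N.E) :
    (M.freeProduct N h).Indep (B ∪ J) ↔ N.Indep J := by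
  constructor
  · intro hI
    obtain ⟨B', hB', hIB'⟩ := hI.exists_isBase_superset
    have hB'M : B = B' ∩ M.E := hB.eq_of_subset_indep hB'.2.2.1
      (subset_inter (subset_union_left.trans hIB') hB.subset_ground)
    have hc := encard_inter_add_encard_inter h hB'.1
    rw [hB'.2.1, ← hB'M, hB.encard_eq_eRank] at hc
    replace hc := (ENat.add_right_injective_of_ne_top M.eRank_ne_top_of_finite) hc
    have hi : N.Indep (B' ∩ N.E) := by
      rw [indep_iff_eRk_eq_encard_of_finite (N.ground_finite.subset inter_subset_right), hc,
        hB'.2.2.2.eRk_eq]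
    exact hi.subset (subset_inter (subset_union_right.trans hIB') hJ)
  · intro hJ
    obtain ⟨B', hB', hJB'⟩ := hJ.exists_isBase_superset
    exact (freeProduct_indep_union h hB.indep hB'.spanning (by
      rw [hB.encard_eq_eRank, hB'.encard_eq_eRank])).subset (union_subset_union_right _ hJB')

theorem freeProduct_restrict : (M.freeProduct N h) ↾ M.E = M := by
  refine ext_indep rfl fun I hI ↦ ?_
  exact restrict_indep_iff.trans
    ((and_iff_left hI).trans (freeProduct_indep_iff_of_subset_left h hI))

theorem IsBase.freeProduct_isBasis {B : Set α} (hB : M.IsBase B) :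
    (M.freeProduct N h).IsBasis B M.E := by
  refine ((freeProduct_indep_iff_of_subset_left h hB.subset_ground).2
    hB.indep).isBasis_of_forall_insert hB.subset_ground fun e he ↦ ?_
  rw [Dep, freeProduct_indep_iff_of_subset_left h (insert_subset he.1 hB.subset_ground)]
  refine ⟨(hB.insert_dep he).not_indep, ?_⟩
  exact (insert_subset he.1 hB.subset_ground).trans subset_union_left

theorem freeProduct_contract : (M.freeProduct N h) ／ M.E = N := by
  obtain ⟨B, hB⟩ := M.exists_isBase
  have hE : ((M.freeProduct N h) ／ M.E).E = N.E := by
    rw [contract_ground, freeProduct_ground, union_sdiff_left, h.symm.sdiff_eq_left]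
  refine ext_indep hE fun J hJ ↦ ?_
  rw [hE] at hJ
  rw [(hB.freeProduct_isBasis h).contract_indep_iff_of_disjoint (h.mono_right hJ), union_comm,
    freeProduct_indep_union_iff h hB hJ]

theorem closure_eq_freeProduct_closure_inter {X : Set α} (hX : X ⊆ M.E) :
    M.closure X = (M.freeProduct N h).closure X ∩ M.E := by
  conv_lhs => rw [← freeProduct_restrict h]
  rw [restrict_closure_eq _ hX subset_union_left]

theorem closure_eq_freeProduct_closure_sdiff (X : Set α) :
    N.closure X = (M.freeProduct N h).closure (X ∪ M.E) \ M.E := by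
  conv_lhs => rw [← freeProduct_contract h]
  rw [contract_closure_eq]

/-- An element of `M` in an independent set of `M □ N` can be exchanged for any element of `N`. -/
theorem Indep.freeProduct_exchange {J : Set α} {e x : α}
    (hJ : (M.freeProduct N h).Indep (insert e J)) (he : e ∈ M.E) (heJ : e ∉ J) (hx : x ∈ N.E) :
    (M.freeProduct N h).Indep (insert x J) := by
  obtain ⟨B, hB, hJB⟩ := hJ.exists_isBase_superset
  obtain ⟨heB, hJB⟩ := insert_subset_iff.1 hJB
  by_cases hxB : x ∈ B
  · exact hB.indep.subset (insert_subset hxB hJB)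
  have heN : e ∉ N.E := fun heN ↦ h.le_bot ⟨he, heN⟩
  have hxM : x ∉ M.E := fun hxM ↦ h.le_bot ⟨hxM, hx⟩
  -- The swap only shrinks the part in E(M) and enlarges the part in E(N), so independence in `M`
  -- and spanning in `N` both survive.
  have hB' : (M.freeProduct N h).IsBase (insert x (B \ {e})) := by
    refine ⟨insert_subset (Or.inr hx) (sdiff_subset.trans hB.1), ?_, ?_, ?_⟩
    · rw [encard_insert_of_notMem (fun hh ↦ hxB hh.1), encard_sdiff_singleton_add_one heB, hB.2.1]
    · rw [insert_inter_of_notMem hxM]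
      exact hB.2.2.1.subset (inter_subset_inter_left _ sdiff_subset)
    · refine hB.2.2.2.superset (fun y hy ↦ ⟨Or.inr ⟨hy.1, ?_⟩, hy.2⟩) inter_subset_right
      rintro rfl
      exact heN hy.2
  exact hB'.indep.subset (insert_subset_insert
    fun y hy ↦ ⟨hJB hy, by rintro rfl; exact heJ hy⟩)

/-- The closure in `M □ N` of a circuit that spans an element of `N` contains `M`. -/
theorem IsCircuit.ground_subset_freeProduct_closure {C : Set α} {x : α}
    (hC : (M.freeProduct N h).IsCircuit C) (hx : x ∈ (M.freeProduct N h).closure C)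
    (hxN : x ∈ N.E) : M.E ⊆ (M.freeProduct N h).closure C := by
  -- A basis of C avoiding x: if some e of E(M) outside its closure could be added, exchange would
  -- allow adding x instead, although C spans x.
  obtain ⟨J, hJC, hxJ⟩ : ∃ J, (M.freeProduct N h).IsBasis J C ∧ x ∉ J := by
    by_cases hxC : x ∈ C
    · exact ⟨C \ {x}, hC.sdiff_singleton_isBasis hxC, fun hh ↦ hh.2 rfl⟩
    · obtain ⟨J, hJ⟩ := (M.freeProduct N h).exists_isBasis C hC.subset_ground
      exact ⟨J, hJ, fun hxJ ↦ hxC (hJ.subset hxJ)⟩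
  rw [← hJC.closure_eq_closure] at hx ⊢
  intro e he
  rw [hJC.indep.mem_closure_iff']
  refine ⟨Or.inl he, fun hi ↦ ?_⟩
  by_contra heJ
  exact hxJ ((hJC.indep.mem_closure_iff'.1 hx).2 (hi.freeProduct_exchange h he heJ hxN))

/-- Complementation turns independence in `M` into spanning in `M✶` and spanning in `N` into
independence in `N✶`, so the factors trade roles. -/
theorem freeProduct_dual : (M.freeProduct N h)✶ =
    N✶.freeProduct M✶ (show Disjoint N✶.E M✶.E from h.symm) := by
  have hE : (M.freeProduct N h).E = N.E ∪ M.E := union_comm _ _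
  refine ext_isBase hE fun B hB ↦ ?_
  have hB' : B ⊆ M.E ∪ N.E := hB
  rw [dual_isBase_iff hB']
  have hM : ((M.E ∪ N.E) \ B) ∩ M.E = M.E \ (B ∩ M.E) := by
    ext x; simp; tauto
  have hN : ((M.E ∪ N.E) \ B) ∩ N.E = N.E \ (B ∩ N.E) := by
    ext x; simp; tauto
  have h1 : N✶.Indep (B ∩ N.E) ↔ N.Spanning (N.E \ (B ∩ N.E)) :=
    N.coindep_iff_compl_spanning inter_subset_right
  have h2 : M✶.Spanning (B ∩ M.E) ↔ M.Indep (M.E \ (B ∩ M.E)) := by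
    rw [spanning_iff_compl_coindep (show B ∩ M.E ⊆ M✶.E from inter_subset_right),
      dual_coindep_iff, dual_ground]
  have h3 : ((M.E ∪ N.E) \ B).encard = M.eRank + N.eRank ↔ B.encard = N✶.eRank + M✶.eRank := by
    have e1 := encard_sdiff_add_encard_of_subset hB'
    rw [encard_union_eq h] at e1
    have e2 := M.eRank_add_eRank_dual
    have e3 := N.eRank_add_eRank_dual
    have f1 := M.eRank_ne_top_of_finite
    have f2 := N.eRank_ne_top_of_finite
    have f3 := M✶.eRank_ne_top_of_finite
    have f4 := N✶.eRank_ne_top_of_finite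
    have f5 : B.encard ≠ ⊤ :=
      encard_ne_top_iff.2 ((M.ground_finite.union N.ground_finite).subset hB')
    have f6 : ((M.E ∪ N.E) \ B).encard ≠ ⊤ :=
      encard_ne_top_iff.2 ((M.ground_finite.union N.ground_finite).subset sdiff_subset)
    rw [← e2, ← e3] at e1
    clear e2 e3
    generalize ((M.E ∪ N.E) \ B).encard = a at *
    generalize B.encard = b at *
    generalize M.eRank = c at *
    generalize N.eRank = d at *
    generalize M✶.eRank = c' at *
    generalize N✶.eRank = d' at *
    lift a to ℕ using f6
    lift b to ℕ using f5
    lift c to ℕ using f1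
    lift d to ℕ using f2
    lift c' to ℕ using f3
    lift d' to ℕ using f4
    norm_cast at *
    omega
  rw [freeProduct_isBase_iff, freeProduct_isBase_iff, IsFreeProductBase, IsFreeProductBase,
    freeProduct_ground, hM, hN, h3, ← h1, ← h2, dual_ground, dual_ground]
  have := union_comm M.E N.E
  exact ⟨fun h ↦ ⟨this ▸ hB', h.2.1, h.2.2.2, h.2.2.1⟩,
    fun h ↦ ⟨sdiff_subset, h.2.1, h.2.2.2, h.2.2.1⟩⟩

end FreeProduct

/-! ### A circuit criterion for fundamental transversal matroids. -/

section Fundamental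

variable {α : Type*} {M : Matroid α} [M.Finite]

/-- The base consists of private elements. Let W index the sets meeting a circuit C. By Hall, |W| =
|C| - 1 = r(C). If some private element of a set in W were outside cl(C), it could replace an
element of C to give |C| independent elements that meet only sets in W. So these |W| independent
elements lie in cl(C) and span C. -/
theorem IsFundamentalTransversal.exists_isBase (h : M.IsFundamentalTransversal) :
    ∃ B, M.IsBase B ∧ ∀ C, M.IsCircuit C → C ⊆ M.closure (B ∩ M.closure C) := by
  obtain ⟨r, A, y, hA, hy⟩ := h.exists_presents
  have hyinj : Function.Injective y := fun i j hij ↦ (hy j i).1 (hij ▸ (hy i i).2 rfl)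
  have hyI : M.Indep (range y) := hA.indep_range hy
  have hyc : ∀ W : Set (Fin r), (y '' W).encard = W.encard := fun W ↦ hyinj.encard_image W
  have hyE : ∀ i, y i ∈ M.E := fun i ↦ hyI.subset_ground (mem_range_self i)
  refine ⟨range y, ?_, fun C hC ↦ ?_⟩
  · refine hyI.isBase_of_eRk_ge (finite_range y) ?_
    rw [hyI.eRk_eq_encard, ← image_univ, hyc, hA.encard_univ_eq hy]
  have hfin : ∀ X ⊆ M.E, X.Finite := fun X hX ↦ M.ground_finite.subset hX
  have hall : ∀ X ⊆ M.E, (M.Indep X ↔ ∀ D ⊆ X, D.encard ≤ (nbhd A D).encard) := fun X hX ↦ by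
    rw [hA X, linkable_iff (hfin X hX)]
    simp
  have hlt : (nbhd A C).encard < C.encard := by
    have := hC.not_indep
    rw [hall C hC.subset_ground] at this
    push Not at this
    obtain ⟨D, hDC, hD⟩ := this
    rwa [← hC.eq_of_not_indep_subset (fun hi ↦
      hD.not_ge ((hall D hi.subset_ground).1 hi D subset_rfl)) hDC]
  obtain ⟨z, hz⟩ := hC.nonempty
  have hle : C.encard ≤ (nbhd A C).encard + 1 := by
    have hi := hC.sdiff_singleton_indep hz
    rw [← encard_sdiff_singleton_add_one hz]
    gcongr
    exact ((hall _ hi.subset_ground).1 hi _ subset_rfl).trans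
      (encard_le_encard (nbhd_mono A sdiff_subset))
  have hcl : y '' nbhd A C ⊆ M.closure C := by
    rintro _ ⟨i, hi, rfl⟩
    by_contra hyi
    have hyC : y i ∉ C := fun hh ↦ hyi (M.mem_closure_of_mem hh hC.subset_ground)
    have hins : M.Indep (insert (y i) (C \ {z})) := by
      rw [(hC.sdiff_singleton_indep hz).insert_indep_iff_of_notMem (fun hh ↦ hyC hh.1)]
      exact ⟨hyE i, fun hh ↦ hyi (M.closure_subset_closure sdiff_subset hh)⟩
    have h1 := (hall _ hins.subset_ground).1 hins _ subset_rfl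
    rw [encard_insert_of_notMem (fun hh ↦ hyC hh.1), encard_sdiff_singleton_add_one hz] at h1
    refine (h1.trans (encard_le_encard ?_)).not_gt hlt
    rintro j ⟨x, hxj, rfl | hx⟩
    · rwa [(hy _ _).1 hxj]
    · exact ⟨x, hxj, hx.1⟩
  have hWI : M.Indep (y '' nbhd A C) := hyI.subset (image_subset_range _ _)
  have hsub : C ⊆ M.closure (y '' nbhd A C) := by
    intro c hc
    by_contra hcW
    have hcE := hC.subset_ground hc
    have hcW' : c ∉ y '' nbhd A C := fun hh ↦ hcW (M.mem_closure_of_mem hh hWI.subset_ground)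
    have hins : M.Indep (insert c (y '' nbhd A C)) :=
      (hWI.insert_indep_iff_of_notMem hcW').2 ⟨hcE, hcW⟩
    have h1 := hins.encard_le_eRk_of_subset
      (insert_subset (M.mem_closure_of_mem hc hC.subset_ground) hcl)
    rw [eRk_closure_eq, encard_insert_of_notMem hcW', hyc] at h1
    have h2 := hC.eRk_add_one_eq
    have h3 : C.encard ≠ ⊤ := encard_ne_top_iff.2 (hfin C hC.subset_ground)
    have h4 : C.encard + 1 ≤ C.encard := by
      rw [← h2] at hle ⊢
      exact add_le_add_left ((hle).trans h1) 1
    exact ((ENat.lt_add_one_iff h3).2 le_rfl).not_ge h4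
  exact hsub.trans (M.closure_subset_closure (subset_inter (image_subset_range _ _) hcl))

/-- The presenting sets are the fundamental cocircuits E \ cl(B - x) of the base. Every independent
set satisfies Hall's condition for them, whatever the base. The hypothesis serves the converse: only
cocircuits with x in B ∩ cl(C) can meet a circuit C, and there are at most r(C) < |C| of those. -/
theorem IsBase.isFundamentalTransversal {B : Set α} (hB : M.IsBase B)
    (h : ∀ C, M.IsCircuit C → C ⊆ M.closure (B ∩ M.closure C)) : M.IsFundamentalTransversal := by
  have hBf : Finite B := (M.ground_finite.subset hB.subset_ground).to_subtype
  let A : B → Set α := fun x ↦ M.E \ M.closure (B \ {(x : α)})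
  have hpriv : ∀ i j : B, (i : α) ∈ A j → j = i := by
    intro i j hij
    by_contra hne
    exact hij.2 (M.mem_closure_of_mem ⟨i.2, fun hh ↦ hne (Subtype.ext hh.symm)⟩
      (sdiff_subset.trans hB.subset_ground))
  have hself : ∀ i : B, (i : α) ∈ A i := fun i ↦
    ⟨hB.subset_ground i.2, hB.indep.notMem_closure_sdiff_of_mem i.2⟩
  have hcard : ∀ W : Set B, (Subtype.val '' W).encard = W.encard :=
    fun W ↦ Subtype.val_injective.encard_image W
  refine Presents.isFundamentalTransversal (A := A) (S := univ) (fun I ↦ ⟨fun hI ↦ ?_, fun hI ↦ ?_⟩)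
    fun i _ ↦ ⟨i, hself i, fun j _ hij ↦ hpriv i j hij⟩
  · rw [linkable_iff (M.ground_finite.subset hI.subset_ground)]
    intro D hDI
    have hD := hI.subset hDI
    -- Each d outside B is spanned by the rest of its fundamental circuit, whose elements index
    -- cocircuits containing d.
    have hDW : D ⊆ M.closure (Subtype.val '' nbhd A D) := by
      intro d hd
      have hWE : Subtype.val '' nbhd A D ⊆ M.E :=
        (Subtype.coe_image_subset B _).trans hB.subset_ground
      by_cases hdB : d ∈ B
      · exact M.mem_closure_of_mem ⟨⟨d, hdB⟩, ⟨d, hself ⟨d, hdB⟩, hd⟩, rfl⟩ hWE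
      have hdE := hD.subset_ground hd
      have hdcl : d ∈ M.closure B := hB.closure_eq ▸ hdE
      have hF := hB.indep.fundCircuit_isCircuit hdcl hdB
      refine M.closure_subset_closure ?_
        (hF.mem_closure_sdiff_singleton_of_mem (M.mem_fundCircuit d B))
      rintro x ⟨hx, hxd⟩
      have hxd : x ≠ d := hxd
      have hxB : x ∈ B := (M.fundCircuit_subset_insert d B hx).resolve_left hxd
      rw [hB.indep.mem_fundCircuit_iff hdcl hdB,
        ← insert_sdiff_singleton_comm hxd.symm,
        (hB.indep.sdiff _).insert_indep_iff_of_notMem fun hh ↦ hdB hh.1] at hx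
      exact ⟨⟨x, hxB⟩, ⟨d, hx, hd⟩, rfl⟩
    rw [univ_inter, ← hcard, ← hD.eRk_eq_encard]
    exact ((M.eRk_mono hDW).trans (M.eRk_closure_eq _).le).trans (M.eRk_le_encard _)
  · have hIE : I ⊆ M.E := by
      obtain ⟨f, -, hf⟩ := hI
      exact fun x hx ↦ (hf ⟨x, hx⟩).2.1
    by_contra hI'
    obtain ⟨C, hCI, hC⟩ := Dep.exists_isCircuit_subset ⟨hI', hIE⟩
    have h1 := (linkable_iff (M.ground_finite.subset hC.subset_ground)).1 (hI.subset hCI) C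
      subset_rfl
    rw [univ_inter, ← hcard] at h1
    have h2 : Subtype.val '' nbhd A C ⊆ B ∩ M.closure C := by
      rintro _ ⟨x, ⟨c, hcx, hc⟩, rfl⟩
      refine ⟨x.2, by_contra fun hx ↦ hcx.2 (M.closure_subset_closure ?_ (h C hC hc))⟩
      exact fun w hw ↦ ⟨hw.1, fun hwx ↦ hx (hwx ▸ hw.2)⟩
    have h3 := (hB.indep.subset inter_subset_left).encard_le_eRk_of_subset
      (inter_subset_right : B ∩ M.closure C ⊆ _)
    rw [eRk_closure_eq] at h3
    have h4 := (h1.trans (encard_le_encard h2)).trans h3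
    rw [← hC.eRk_add_one_eq] at h4
    have h5 : M.eRk C ≠ ⊤ :=
      ((M.eRk_le_eRank C).trans_lt M.eRank_ne_top_of_finite.lt_top).ne
    exact ((ENat.lt_add_one_iff h5).2 le_rfl).not_ge h4

end Fundamental

/-! ### Fundamental transversality passes to the factors. -/

section FreeProduct

variable {α : Type*} {M N : Matroid α} [M.Finite] [N.Finite] (h : Disjoint M.E N.E)

/-- Allows |B ∩ E(M)| to grow while the circuit criterion is kept. The removed x is an element of
E(N) on the fundamental circuit of e. A circuit whose closure contains x spans all of E(M), hence e,
so e can stand in for x there; for any other circuit x was not in use. -/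
theorem freeProduct_exchange_isBase {B : Set α} (hB : (M.freeProduct N h).IsBase B)
    (hBC : ∀ C, (M.freeProduct N h).IsCircuit C →
      C ⊆ (M.freeProduct N h).closure (B ∩ (M.freeProduct N h).closure C))
    {e : α} (he : e ∈ M.E) (heB : e ∉ (M.freeProduct N h).closure (B ∩ M.E)) :
    ∃ x ∈ N.E, (M.freeProduct N h).IsBase (insert e (B \ {x})) ∧
      ∀ C, (M.freeProduct N h).IsCircuit C →
        C ⊆ (M.freeProduct N h).closure
          (insert e (B \ {x}) ∩ (M.freeProduct N h).closure C) := by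
  set G := M.freeProduct N h with hG
  have heE : e ∈ G.E := Or.inl he
  have heB' : e ∉ B := fun hh ↦
    heB (G.mem_closure_of_mem' ⟨hh, he⟩ heE)
  have hecl : e ∈ G.closure B := hB.closure_eq ▸ heE
  have hF := hB.indep.fundCircuit_isCircuit hecl heB'
  obtain ⟨x, hxF, hxe, hxM⟩ : ∃ x ∈ G.fundCircuit e B, x ≠ e ∧ x ∉ M.E := by
    by_contra! hcon
    refine heB (G.closure_subset_closure ?_
      (hF.mem_closure_sdiff_singleton_of_mem (G.mem_fundCircuit e B)))
    exact fun x hx ↦ ⟨(G.fundCircuit_subset_insert e B hx.1).resolve_left hx.2, hcon x hx.1 hx.2⟩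
  have hxB : x ∈ B := (G.fundCircuit_subset_insert e B hxF).resolve_left hxe
  have hxN : x ∈ N.E := (hB.subset_ground hxB).resolve_left hxM
  have hind : G.Indep (insert e (B \ {x})) := by
    rwa [hB.indep.mem_fundCircuit_iff hecl heB', ← insert_sdiff_singleton_comm hxe.symm] at hxF
  have hex : e ∉ G.closure (B \ {x}) :=
    (((hB.indep.sdiff {x}).insert_indep_iff_of_notMem fun hh ↦ heB' hh.1).1 hind).2
  refine ⟨x, hxN, hB.exchange_isBase_of_indep heB' hind, fun C hC ↦ ?_⟩
  by_cases hxC : x ∈ G.closure C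
  · have heC : e ∈ G.closure C := hC.ground_subset_freeProduct_closure h hxC hxN he
    set K := B ∩ G.closure C with hK
    have hKE : K ⊆ G.E := inter_subset_left.trans hB.subset_ground
    have hCK : G.closure C ⊆ G.closure K := G.closure_subset_closure_of_subset_closure (hBC C hC)
    have hKx : insert x (K \ {x}) = K := by
      rw [insert_sdiff_singleton, insert_eq_of_mem (show x ∈ K from ⟨hxB, hxC⟩)]
    have hxcl : x ∈ G.closure (insert e (K \ {x})) := by
      refine mem_closure_insert (fun hh ↦ hex (G.closure_subset_closure ?_ hh)) ?_
      · exact sdiff_subset_sdiff_left inter_subset_left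
      · rw [hKx]; exact hCK heC
    have hKcl : K ⊆ G.closure (insert e (K \ {x})) := by
      intro k hk
      by_cases hkx : k = x
      · rwa [hkx]
      · exact G.mem_closure_of_mem' (Or.inr ⟨hk, hkx⟩) (hKE hk)
    refine ((hBC C hC).trans (G.closure_subset_closure_of_subset_closure hKcl)).trans
      (G.closure_subset_closure ?_)
    exact insert_subset ⟨mem_insert _ _, heC⟩ fun k hk ↦ ⟨Or.inr ⟨hk.1.1, hk.2⟩, hk.1.2⟩
  · refine (hBC C hC).trans (G.closure_subset_closure fun k hk ↦ ⟨Or.inr ⟨hk.1, ?_⟩, hk.2⟩)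
    rintro rfl
    exact hxC hk.2

theorem IsFundamentalTransversal.of_freeProduct
    (hG : (M.freeProduct N h).IsFundamentalTransversal) :
    M.IsFundamentalTransversal ∧ N.IsFundamentalTransversal := by
  set G := M.freeProduct N h with hGdef
  have hfin : {B | G.IsBase B ∧ ∀ C, G.IsCircuit C → C ⊆ G.closure (B ∩ G.closure C)}.Finite :=
    G.ground_finite.finite_subsets.subset fun B hB ↦ hB.1.subset_ground
  -- Maximality of |B ∩ E(M)| forces B ∩ E(M) to span E(M).
  obtain ⟨B, ⟨hB, hBC⟩, hmax⟩ := exists_max_image _ (fun B ↦ (B ∩ M.E).ncard) hfin hG.exists_isBase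
  have hcl : M.E ⊆ G.closure (B ∩ M.E) := by
    intro e he
    by_contra heB
    obtain ⟨x, hx, hB'⟩ := freeProduct_exchange_isBase h hB hBC he heB
    have h1 := hmax _ hB'
    have heq : insert e (B \ {x}) ∩ M.E = insert e (B ∩ M.E) := by
      rw [insert_inter_of_mem he]
      congr 1
      ext z
      refine ⟨fun hz ↦ ⟨hz.1.1, hz.2⟩, fun hz ↦ ⟨⟨hz.1, ?_⟩, hz.2⟩⟩
      rintro rfl
      exact h.le_bot ⟨hz.2, hx⟩
    have heB' : e ∉ B ∩ M.E := fun hh ↦ heB (G.mem_closure_of_mem' hh (Or.inl he))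
    simp only [heq] at h1
    rw [ncard_insert_of_notMem heB' (M.ground_finite.subset inter_subset_right)] at h1
    omega
  have hBM : M.IsBase (B ∩ M.E) := by
    rw [isBase_iff_indep_closure_eq, closure_eq_freeProduct_closure_inter h inter_subset_right]
    exact ⟨hB.2.2.1, inter_eq_right.2 hcl⟩
  have hBN : N.IsBase (B ∩ N.E) := by
    refine Indep.isBase_of_spanning ?_ hB.2.2.2
    rw [← freeProduct_indep_union_iff h hBM inter_subset_right, inter_union_inter_eq hB.1]
    exact hB.indep
  refine ⟨hBM.isFundamentalTransversal fun C hC ↦ ?_, hBN.isFundamentalTransversal fun C hC ↦ ?_⟩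
  · have hCE := hC.subset_ground
    have hCG : G.IsCircuit C := by
      rw [← freeProduct_restrict h, restrict_isCircuit_iff (R := M.E) subset_union_left] at hC
      exact hC.1
    -- Either cl(C) reaches E(N) and then contains the whole base B ∩ E(M), or it stays inside E(M)
    -- and the criterion in G restricts verbatim.
    by_cases hx : ∃ x ∈ N.E, x ∈ G.closure C
    · obtain ⟨x, hxN, hx⟩ := hx
      have hM := hCG.ground_subset_freeProduct_closure h hx hxN
      rw [closure_eq_freeProduct_closure_inter h hCE, inter_eq_right.2 hM,
        inter_eq_left.2 inter_subset_right, hBM.closure_eq]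
      exact hCE
    · push Not at hx
      have hCM : G.closure C ⊆ M.E := fun z hz ↦
        (G.closure_subset_ground C hz).resolve_right fun hzN ↦ hx z hzN hz
      rw [closure_eq_freeProduct_closure_inter h hCE, inter_assoc, ← inter_assoc M.E,
        inter_comm M.E, inter_assoc, inter_self, inter_eq_left.2 hCM,
        closure_eq_freeProduct_closure_inter h (inter_subset_right.trans hCM)]
      exact subset_inter (hBC C hCG) hCE
  · have hCE := hC.subset_ground
    -- C is lifted to a circuit D of G with D ∩ E(N) = C. Since cl(D) ⊆ cl(C ∪ E(M)), contracting
    -- E(M) turns the criterion for D into that for C.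
    have hdep : G.Dep ((B ∩ M.E) ∪ C) := by
      refine ⟨fun hi ↦ hC.not_indep ((freeProduct_indep_union_iff h hBM hCE).1 hi), ?_⟩
      exact union_subset_union inter_subset_right hCE
    obtain ⟨D, hDC, hD⟩ := hdep.exists_isCircuit_subset
    have hDN : D ∩ N.E ⊆ C := by
      rintro z ⟨hzD, hzN⟩
      exact (hDC hzD).resolve_left fun hzB ↦ h.le_bot ⟨hzB.2, hzN⟩
    have hDC' : D ∩ N.E = C := by
      refine hC.eq_of_not_indep_subset (fun hi ↦ hD.not_indep ?_) hDN
      refine ((freeProduct_indep_union_iff h hBM inter_subset_right).2 hi).subset fun z hz ↦ ?_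
      exact (hDC hz).imp id fun hzC ↦ ⟨hz, hCE hzC⟩
    obtain ⟨c, hc⟩ := hC.nonempty
    have hcD : c ∈ D ∩ N.E := hDC' ▸ hc
    have hDE := hD.subset_ground
    have hMD : M.E ⊆ G.closure D := hD.ground_subset_freeProduct_closure h
      (G.mem_closure_of_mem hcD.1 hDE) hcD.2
    have hclD : G.closure D ⊆ G.closure (C ∪ M.E) := by
      refine G.closure_subset_closure fun z hz ↦ ?_
      exact (hDE hz).symm.imp (fun hzN ↦ hDC' ▸ ⟨hz, hzN⟩) id
    intro z hz
    have hzD : z ∈ D ∩ N.E := hDC' ▸ hz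
    have hzM : z ∉ M.E := fun hzM ↦ h.le_bot ⟨hzM, hzD.2⟩
    rw [closure_eq_freeProduct_closure_sdiff h, closure_eq_freeProduct_closure_sdiff h C]
    refine ⟨G.closure_subset_closure (fun w hw ↦ ?_) (hBC D hD hzD.1), hzM⟩
    by_cases hwM : w ∈ M.E
    · exact Or.inr hwM
    · exact Or.inl ⟨⟨hw.1, (hB.1 hw.1).resolve_left hwM⟩, hclD hw.2, hwM⟩

end FreeProduct

/-! ### Presentations of the free product and of its factors. -/

section Image

variable {α ι κ : Type*} {A : ι → Set α} {C : κ → Set α} {S : Set ι} {I : Set α} {g : ι → κ}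

theorem Linkable.image (h : Linkable A S I) (hg : Function.Injective g)
    (hC : ∀ i ∈ S, A i ⊆ C (g i)) : Linkable C (g '' S) I := by
  obtain ⟨f, hf, h⟩ := h
  exact ⟨fun x ↦ g (f x), hg.comp hf,
    fun x ↦ ⟨mem_image_of_mem g (h x).1, hC _ (h x).1 (h x).2⟩⟩

theorem Linkable.of_image (h : Linkable C (g '' S) I) : Linkable (fun i ↦ C (g i)) S I := by
  obtain ⟨f, hf, h⟩ := h
  choose k hk hkf using fun x ↦ (h x).1
  refine ⟨k, fun x y hxy ↦ hf ?_, fun x ↦ ⟨hk x, ?_⟩⟩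
  · rw [← hkf, ← hkf, hxy]
  · have := (h x).2
    rwa [← hkf] at this

end Image

theorem Presents.restrict {α ι : Type*} {M : Matroid α} {A : ι → Set α} {S : Set ι}
    (h : M.Presents A S) (R : Set α) : (M ↾ R).Presents (fun i ↦ A i ∩ R) S := by
  intro I
  rw [restrict_indep_iff, h I]
  refine ⟨fun hI ↦ hI.1.mono subset_rfl fun x hx i hi hxi ↦ ⟨hi, hxi, hI.2 hx⟩, fun hI ↦
    ⟨hI.mono subset_rfl fun x hx i hi hxi ↦ ⟨hi, hxi.1⟩, fun x hx ↦ ?_⟩⟩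
  obtain ⟨f, -, hf⟩ := hI
  exact (hf ⟨x, hx⟩).2.2

section FreeProduct

variable {α ι κ : Type*} {M N : Matroid α} [M.Finite] [N.Finite] (h : Disjoint M.E N.E)

/-- Having exactly r(M) sets for `M` makes the counts agree: what a base has in E(N) beyond a base
of `N` equals the number of sets of `S` not used by its part in E(M). -/
theorem Presents.freeProduct {A : ι → Set α} {S : Set ι} {B : κ → Set α} {T : Set κ}
    (hA : M.Presents A S) (hS : S.encard = M.eRank) (hB : N.Presents B T) {Y : Set α}
    (hY : N.Indep Y) :
    (M.freeProduct N h).Presents (Sum.elim (fun i ↦ A i ∪ (N.E \ Y)) B)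
      (Sum.inl '' S ∪ Sum.inr '' T) := by
  have hMfin : ∀ X ⊆ M.E, X.Finite := fun X hX ↦ M.ground_finite.subset hX
  have hNfin : ∀ X ⊆ N.E, X.Finite := fun X hX ↦ N.ground_finite.subset hX
  intro I
  constructor
  · intro hI
    obtain ⟨X, hX, hIX⟩ := hI.exists_isBase_superset
    obtain ⟨hXE, hXc, hXM, hXN⟩ := hX
    refine Linkable.subset ?_ hIX
    obtain ⟨S', hS'S, hS', hXS'⟩ := ((hA _).1 hXM).exists_image
    -- J is made to contain the part of Y in X, so that the surplus elements avoid Y and lie in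
    -- every enlarged set.
    obtain ⟨J, hJ, hYJ⟩ := (hY.inter_right (X ∩ N.E)).subset_isBasis_of_subset inter_subset_right
    have hJB : N.IsBase J := hJ.isBase_of_spanning hXN
    have hc : ((X ∩ N.E) \ J).encard = (S \ S').encard := by
      have h1 := encard_inter_add_encard_inter h hXE
      have h2 := encard_sdiff_add_encard_of_subset hJ.subset
      have h3 := encard_sdiff_add_encard_of_subset hS'S
      rw [hJB.encard_eq_eRank] at h2
      rw [hS', hS] at h3
      rw [hXc, ← h2, ← h3] at h1
      have f1 : (X ∩ M.E).encard ≠ ⊤ := encard_ne_top_iff.2 (hMfin _ inter_subset_right)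
      have h4 : ((X ∩ M.E).encard + N.eRank) + ((X ∩ N.E) \ J).encard =
          ((X ∩ M.E).encard + N.eRank) + (S \ S').encard := by
        rw [add_right_comm, add_assoc, h1]
        ring
      exact ENat.add_right_injective_of_ne_top (by
        simp [f1, N.eRank_ne_top_of_finite]) h4
    have hK : Linkable (Sum.elim (fun i ↦ A i ∪ (N.E \ Y)) B) (Sum.inl '' (S \ S'))
        ((X ∩ N.E) \ J) := by
      refine Linkable.image (A := fun i ↦ A i ∪ (N.E \ Y))
        (linkable_of_encard_le hc.le (hNfin _ (sdiff_subset.trans inter_subset_right)) ?_)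
        Sum.inl_injective fun i _ ↦ subset_rfl
      exact fun i _ z hz ↦ Or.inr ⟨hz.1.2, fun hzY ↦ hz.2 (hYJ ⟨hzY, hz.1⟩)⟩
    have h1 : Linkable (Sum.elim (fun i ↦ A i ∪ (N.E \ Y)) B) (Sum.inl '' S') (X ∩ M.E) :=
      hXS'.image Sum.inl_injective fun i _ ↦ subset_union_left
    have h2 : Linkable (Sum.elim (fun i ↦ A i ∪ (N.E \ Y)) B) (Sum.inr '' T) J :=
      ((hB J).1 hJB.indep).image Sum.inr_injective fun i _ ↦ subset_rfl
    have h3 := h1.union hK (by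
      rw [disjoint_image_iff Sum.inl_injective]; exact disjoint_sdiff_right)
    rw [← image_union, union_sdiff_cancel hS'S] at h3
    refine (h3.union h2 ?_).subset ?_
    · rw [Set.disjoint_left]
      rintro _ ⟨i, -, rfl⟩ ⟨j, -, hj⟩
      cases hj
    · rw [union_assoc, sdiff_union_of_subset hJ.subset, inter_union_inter_eq hXE]
  · intro hI
    obtain ⟨P, J, hPJ, -, hP, hJ⟩ := hI.exists_split
    have hP := hP.of_image
    have hJN : N.Indep J := (hB J).2 hJ.of_image
    have hAE : ∀ i ∈ S, A i ⊆ M.E := fun i hi ↦ hA.subset_ground hi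
    have hPE : P ⊆ M.E ∪ N.E := by
      obtain ⟨f, -, hf⟩ := hP
      exact fun x hx ↦ (hf ⟨x, hx⟩).2.imp (fun hh ↦ hAE _ (hf ⟨x, hx⟩).1 hh) fun hh ↦ hh.1
    have hPM : M.Indep (P ∩ M.E) := by
      refine (hA _).2 (hP.mono inter_subset_left fun x hx i hi hxi ↦ ⟨hi, ?_⟩)
      exact hxi.resolve_right fun hh ↦ h.le_bot ⟨hx.2, hh.1⟩
    obtain ⟨J', hJ', hJJ'⟩ := hJN.exists_isBase_superset
    have hZ : N.Spanning (J' ∪ (P ∩ N.E)) := hJ'.spanning.superset subset_union_left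
      (union_subset hJ'.subset_ground inter_subset_right)
    refine (freeProduct_indep_union h hPM hZ ?_).subset ?_
    · calc (P ∩ M.E).encard + (J' ∪ (P ∩ N.E)).encard
          ≤ (P ∩ M.E).encard + (J'.encard + (P ∩ N.E).encard) := by
            gcongr; exact encard_union_le _ _
        _ = P.encard + N.eRank := by
            rw [add_left_comm, encard_inter_add_encard_inter h hPE, hJ'.encard_eq_eRank, add_comm]
        _ ≤ _ := by gcongr; exact hP.encard_le.trans hS.le
    · rw [← hPJ]
      nth_rw 1 [← inter_union_inter_eq hPE]
      refine union_subset (union_subset subset_union_left ?_) ?_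
      · exact subset_union_right.trans subset_union_right
      · exact hJJ'.trans (subset_union_left.trans subset_union_right)

theorem IsTransversal.freeProduct (hM : M.IsTransversal) (hN : N.IsTransversal) :
    (M.freeProduct N h).IsTransversal := by
  obtain ⟨r, A, hA⟩ := hM
  obtain ⟨s, B, hB⟩ := hN
  obtain ⟨S, -, hS, hA⟩ := (isPresentation_iff.1 hA).exists_encard_eq_eRank
  exact (hA.freeProduct h hS (isPresentation_iff.1 hB) N.empty_indep).isTransversal

theorem IsFundamentalTransversal.freeProduct (hM : M.IsFundamentalTransversal)
    (hN : N.IsFundamentalTransversal) : (M.freeProduct N h).IsFundamentalTransversal := by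
  obtain ⟨r, A, y, hA, hy⟩ := hM.exists_presents
  obtain ⟨s, B, z, hB, hz⟩ := hN.exists_presents
  have hyE : ∀ i, y i ∈ M.E := fun i ↦ hA.subset_ground (mem_univ i) ((hy i i).2 rfl)
  have hzE : ∀ i, z i ∈ N.E := fun i ↦ hB.subset_ground (mem_univ i) ((hz i i).2 rfl)
  refine (hA.freeProduct h (hA.encard_univ_eq hy) hB (hB.indep_range hz)).isFundamentalTransversal ?_
  rintro (i | j) -
  · refine ⟨y i, Or.inl ((hy i i).2 rfl), ?_⟩
    rintro (i' | j') - hmem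
    · rcases hmem with hmem | hmem
      · rw [(hy i i').1 hmem]
      · exact (h.le_bot ⟨hyE i, hmem.1⟩).elim
    · exact (h.le_bot ⟨hyE i, hB.subset_ground (mem_univ j') hmem⟩).elim
  · refine ⟨z j, (hz j j).2 rfl, ?_⟩
    rintro (i' | j') - hmem
    · rcases hmem with hmem | hmem
      · exact (h.le_bot ⟨hA.subset_ground (mem_univ i') hmem, hzE j⟩).elim
      · exact (hmem.2 (mem_range_self j)).elim
    · rw [(hz j j').1 hmem]

/-- Suppose D violates Hall's condition for `A` but is linkable after the enlargement. Then x ∈ D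
and D misses `A i`, so D - x is matched without `A i`, which is free to take e. Thus D - x + e is
independent, and exchanging e for x makes D independent, a contradiction. -/
theorem Presents.freeProduct_update [Finite ι] [DecidableEq ι] {A : ι → Set α}
    (hA : (M.freeProduct N h).Presents A univ) {i : ι} {e x : α} (he : e ∈ A i) (heM : e ∈ M.E)
    (hx : x ∈ N.E) :
    (M.freeProduct N h).Presents (Function.update A i (insert x (A i))) univ := by
  set A' := Function.update A i (insert x (A i)) with hA'
  have hAA' : ∀ j, A j ⊆ A' j := by
    intro j
    by_cases hj : j = i
    · subst hj
      simp [hA']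
    · simp [hA', hj]
  have hA'A : ∀ j z, z ≠ x → z ∈ A' j → z ∈ A j := by
    intro j z hzx hz
    by_cases hj : j = i
    · subst hj
      simpa [hA', hzx] using hz
    · simpa [hA', hj] using hz
  have hA'j : ∀ j, j ≠ i → A' j = A j := fun j hj ↦ by simp [hA', hj]
  intro I
  refine ⟨fun hI ↦ ((hA I).1 hI).mono subset_rfl fun z _ j _ hz ↦ ⟨mem_univ _, hAA' j hz⟩,
    fun hI ↦ ?_⟩
  have hIfin : I.Finite := by
    rw [← encard_lt_top_iff]
    exact hI.encard_le.trans_lt finite_univ.encard_lt_top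
  by_contra hI'
  rw [hA I, linkable_iff hIfin] at hI'
  push Not at hI'
  obtain ⟨D, hDI, hD⟩ := hI'
  rw [univ_inter] at hD
  have hDA' := hI.subset hDI
  have hDA : ¬ Linkable A univ D := fun hh ↦ by
    have := (linkable_iff (hIfin.subset hDI)).1 hh D subset_rfl
    rw [univ_inter] at this
    exact this.not_gt hD
  have hxD : x ∈ D := by
    by_contra hxD
    exact hDA (hDA'.mono subset_rfl fun z hz j _ hzj ↦
      ⟨mem_univ _, hA'A j z (fun hh ↦ hxD (hh ▸ hz)) hzj⟩)
  have hi : i ∉ nbhd A D := by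
    intro hi
    have h1 := (linkable_iff (hIfin.subset hDI)).1 hDA' D subset_rfl
    rw [univ_inter] at h1
    refine (h1.trans (encard_le_encard fun j hj ↦ ?_)).not_gt hD
    by_cases hji : j = i
    · rwa [hji]
    · obtain ⟨z, hzj, hz⟩ := hj
      exact ⟨z, hA'j j hji ▸ hzj, hz⟩
  have heD : e ∉ D := fun heD ↦ hi ⟨e, he, heD⟩
  have h1 : Linkable A (nbhd A D) (D \ {x}) := hDA'.mono sdiff_subset fun z hz j _ hzj ↦
    have := hA'A j z hz.2 hzj
    ⟨⟨z, this, hz.1⟩, this⟩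
  have h2 := ((linkable_singleton (mem_singleton i) he).union h1
    (disjoint_singleton_left.2 hi)).mono_right (subset_univ _)
  rw [singleton_union, ← hA] at h2
  have h3 := h2.freeProduct_exchange h heM (fun hh ↦ heD hh.1) hx
  rw [insert_sdiff_singleton, insert_eq_of_mem hxD, hA] at h3
  exact hDA h3

theorem IsTransversal.exists_presents_freeProduct (hG : (M.freeProduct N h).IsTransversal) :
    ∃ (r : ℕ) (A : Fin r → Set α), (M.freeProduct N h).Presents A univ ∧
      ∀ i, (A i ∩ M.E).Nonempty → N.E ⊆ A i := by
  obtain ⟨r, A₀, hA₀⟩ := hG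
  have hfin : {A : Fin r → Set α | (M.freeProduct N h).Presents A univ}.Finite := by
    refine (Set.Finite.pi fun _ : Fin r ↦
      (M.freeProduct N h).ground_finite.finite_subsets).subset fun A hA i _ ↦ ?_
    exact hA.subset_ground (mem_univ i)
  -- Maximal for inclusion in every coordinate, with the number of sets fixed.
  obtain ⟨A, hA⟩ := hfin.exists_maximal ⟨A₀, isPresentation_iff.1 hA₀⟩
  refine ⟨r, A, hA.prop, ?_⟩
  rintro i ⟨e, he, heM⟩ x hx
  have h1 := hA.le_of_ge (hA.prop.freeProduct_update h he heM hx) (by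
    rw [le_update_iff]
    exact ⟨subset_insert _ _, fun _ _ ↦ le_rfl⟩) i
  rw [Function.update_self] at h1
  exact h1 (mem_insert _ _)

/-- Once `B` occupies the sets in `T`, the others must serve `N`. In Hall's count for B ∪ D with D
nonempty, a set outside `T` that meets B contains E(N) and so meets D as well; hence the sets
outside `T` meeting D number at least |D|. -/
theorem Presents.right_of_freeProduct [Finite ι] {A : ι → Set α}
    (hA : (M.freeProduct N h).Presents A univ) (hAN : ∀ i, (A i ∩ M.E).Nonempty → N.E ⊆ A i)
    {B : Set α} (hB : M.IsBase B) {T : Set ι} (hT : T.encard = B.encard) (hBT : Linkable A T B) :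
    N.Presents (fun i ↦ A i ∩ N.E) Tᶜ := by
  intro J
  constructor
  · intro hJ
    have hJE := hJ.subset_ground
    rw [linkable_iff (N.ground_finite.subset hJE)]
    intro D hDJ
    have hDE := hDJ.trans hJE
    obtain rfl | ⟨d, hd⟩ := D.eq_empty_or_nonempty
    · simp
    have hi := (freeProduct_indep_union_iff h hB hDE).2 (hJ.subset hDJ)
    have hfin : (B ∪ D).Finite := (M.freeProduct N h).ground_finite.subset hi.subset_ground
    have h1 := (linkable_iff hfin).1 ((hA _).1 hi) _ subset_rfl
    rw [univ_inter, encard_union_eq (h.mono hB.subset_ground hDE)] at h1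
    have h2 : nbhd A (B ∪ D) ⊆ T ∪ (Tᶜ ∩ nbhd (fun i ↦ A i ∩ N.E) D) := by
      intro i hi
      by_cases hiT : i ∈ T
      · exact Or.inl hiT
      refine Or.inr ⟨hiT, ?_⟩
      rw [nbhd_union] at hi
      rcases hi with ⟨z, hzi, hz⟩ | ⟨z, hzi, hz⟩
      · exact ⟨d, ⟨hAN i ⟨z, hzi, hB.subset_ground hz⟩ (hDE hd), hDE hd⟩, hd⟩
      · exact ⟨z, ⟨hzi, hDE hz⟩, hz⟩
    have h3 := (h1.trans (encard_le_encard h2)).trans (encard_union_le _ _)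
    rw [hT] at h3
    exact (ENat.add_le_add_iff_left
      (encard_ne_top_iff.2 (M.ground_finite.subset hB.subset_ground))).1 h3
  · intro hJ
    have hJE : J ⊆ N.E := by
      obtain ⟨f, -, hf⟩ := hJ
      exact fun x hx ↦ (hf ⟨x, hx⟩).2.2
    rw [← freeProduct_indep_union_iff h hB hJE, hA]
    have hJ' : Linkable A Tᶜ J := hJ.mono subset_rfl fun _ _ _ hi hx ↦ ⟨hi, hx.1⟩
    exact (hBT.union hJ' disjoint_compl_right).mono_right (subset_univ _)

theorem IsTransversal.of_freeProduct (hG : (M.freeProduct N h).IsTransversal) :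
    M.IsTransversal ∧ N.IsTransversal := by
  obtain ⟨r, A, hA, hAN⟩ := hG.exists_presents_freeProduct
  constructor
  · have := hA.restrict M.E
    rw [freeProduct_restrict] at this
    exact this.isTransversal
  · obtain ⟨B, hB⟩ := M.exists_isBase
    obtain ⟨T, -, hT, hBT⟩ := ((hA B).1 ((freeProduct_indep_iff_of_subset_left h
      hB.subset_ground).2 hB.indep)).exists_image
    exact (hA.right_of_freeProduct h hAN hB hT hBT).isTransversal

theorem freeProduct_isTransversal_iff :
    (M.freeProduct N h).IsTransversal ↔ M.IsTransversal ∧ N.IsTransversal :=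
  ⟨fun hG ↦ hG.of_freeProduct, fun hMN ↦ hMN.1.freeProduct h hMN.2⟩

theorem freeProduct_isCotransversal_iff :
    (M.freeProduct N h).IsCotransversal ↔ M.IsCotransversal ∧ N.IsCotransversal := by
  rw [IsCotransversal, freeProduct_dual, freeProduct_isTransversal_iff, and_comm]
  rfl

theorem freeProduct_isFundamentalTransversal_iff :
    (M.freeProduct N h).IsFundamentalTransversal ↔
      M.IsFundamentalTransversal ∧ N.IsFundamentalTransversal :=
  ⟨fun hG ↦ hG.of_freeProduct, fun hMN ↦ hMN.1.freeProduct h hMN.2⟩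

end FreeProduct

end Matroid

theorem mainTheorem9 {α : Type*} (M N : Matroid α) [M.Finite] [N.Finite]
    (h : Disjoint M.E N.E) :
    ((M.freeProduct N h).IsTransversal ↔ M.IsTransversal ∧ N.IsTransversal) ∧
    ((M.freeProduct N h).IsFundamentalTransversal ↔
      M.IsFundamentalTransversal ∧ N.IsFundamentalTransversal) ∧
    ((M.freeProduct N h).IsCotransversal ↔ M.IsCotransversal ∧ N.IsCotransversal) ∧
    (((M.freeProduct N h).IsTransversal ∧ (M.freeProduct N h).IsCotransversal) ↔
      (M.IsTransversal ∧ M.IsCotransversal) ∧ (N.IsTransversal ∧ N.IsCotransversal)) := by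
  refine ⟨Matroid.freeProduct_isTransversal_iff h, Matroid.freeProduct_isFundamentalTransversal_iff h,
    Matroid.freeProduct_isCotransversal_iff h, ?_⟩
  rw [Matroid.freeProduct_isTransversal_iff, Matroid.freeProduct_isCotransversal_iff]
  exact and_and_and_comm
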